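/- Let $p$ be an odd prime, $f\ge 1$ an integer, $q=p^f=2n+1$, and let $\mathbb F_q$ be a field with $q$ elements. Let $K$ be an algebraically closed field of characteristic $0$ (for example $\mathbb C$ or an algebraic closure of $\mathbb Q_p$). Multiplicative characters $\mathbb F_q^\times\to K^\times$ are extended to $\mathbb F_q$ by the value $0$ at $0$; $\phi_q$ is the quadratic character (the value is $1$ at nonzero squares, $0$ at $0$, and $-1$ at non-squares), and $J_q(\chi,\psi)=\sum_{x\in\mathbb F_q}\chi(x)\psi(1-x)$ is the Jacobi sum. For a generator $\chi$ of the group of multiplicative characters of $\mathbb F_q$ put $$R_q(\chi)=\prod_{0<k<(q-1)/4}\left(J_q(\phi_q,\chi^k)+J_q(\phi_q,\chi^{-k})\right).$$ Then $R_q(\chi)$ is a rational integer $R_q$ that does not depend on the choice of the generator $\chi$, and the following hold. 1. If $f>1$ and $q\ne 9$, then $R_q\equiv 0\pmod p$. 2. If $q=9$, then $R_9=-2$. 3. If $f=1$, then, with $m=\lfloor (n-1)/2\rfloor$ (the number of integers $k$ with $0<k<n/2$), $$R_p\equiv(-1)^{m}\left(\tfrac14\right)^{m(m+1)/2}\prod_{0<k<n/2}\binom{2k}{k}\pmod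 p,$$ where $\tfrac14$ denotes the inverse of $4$ modulo $p$. 4. If $f=1$, then the Legendre symbol $\left(\frac{R_p}{p}\right)$ equals $(-1)^{(p-3)/4}$ when $p\equiv 3\pmod 4$, and equals $1$ when $p\equiv 1\pmod 4$. -/

import Mathlib

/-- The quadratic multiplicative character `φ` of a finite field `F` (value `1` at the nonzero
squares, `0` at `0` and `-1` elsewhere), with values in the field `K`. -/
noncomputable def quadChar (F K : Type*) [Field F] [Fintype F] [Field K] : MulChar F K :=
  open Classical in (quadraticChar F).ringHomComp (Int.castRingHom K)

/-- `χ` generates the group of all multiplicative characters of `F` with values in `K`. -/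
def IsCharGenerator {F K : Type*} [Field F] [Field K] (χ : MulChar F K) : Prop :=
  ∀ ψ : MulChar F K, ψ ∈ Subgroup.zpowers χ

/-- For a finite field `F` with `q` elements and a multiplicative character `χ` of `F`, the
product `∏_{0 < k < (q-1)/4} (J(φ, χ^k) + J(φ, χ^{-k}))`, where `J` is the Jacobi sum and `φ` is
the quadratic character. The condition `k < (q-1)/4` is written as `4 * k < q - 1`. -/
noncomputable def jacobiProduct {F K : Type*} [Field F] [Fintype F] [Field K]
    (χ : MulChar F K) : K :=
  ∏ k ∈ (Finset.range (Fintype.card F)).filter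
      (fun k : ℕ => 0 < k ∧ 4 * k < Fintype.card F - 1),
    (jacobiSum (quadChar F K) (χ ^ (k : ℤ)) + jacobiSum (quadChar F K) (χ ^ (-(k : ℤ))))

open Finset

/-! Write `J_k = J(φ, χ^k) + J(φ, χ^{-k})`. It is even in `k`, and since `χ^n = φ`, the substitution
`x ↦ (1 - x)⁻¹` gives `J_{k+n} = φ(-1) J_k`. Hence `φ(-1)^|k| J_k` is an even function on `ℤ/n`. A
unit modulo `n` permutes the indices `0 < k < n/2` up to sign, so replacing `χ` by `χ^a` with `a`
prime to `2n` leaves the product unchanged (`jacobiPairProduct_pow`). The product formed in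
`ℤ[X]/(Φ_{2n})` is therefore Galois invariant, that is, a rational integer `R`
(`exists_int_jacobiPairProduct`).

Sending `X` to a generator of `Fˣ` instead of a root of unity in `K` reduces `R` to characteristic
`p` and turns `χ` into the identity character. Jacobi sums become power sums, and `J_k` becomes
`-(-1)^n C(2n-k, n)` (`jacobiPairSum_identityChar`). For `f > 1`, `q ≠ 9`, Lucas' theorem makes one
of these vanish. For `q = 9` the single factor `J_1` is evaluated exactly by means of Frobenius. For
`f = 1`, `2n + 1 = 0` gives `C(2n-k, n) = (-1)^(n+k) C(n, k)` and `(-4)^k C(n, k) = C(2k, k)`.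

For the Legendre symbol, half a row of binomials is, up to squares, an expression in `2` and
factorials, because superfactorials telescope modulo squares. When `p ≡ 1 (mod 4)` Wilson's theorem
finishes. When `p ≡ 3 (mod 4)`, the remaining factorial symbols follow from the vanishing of the
quadratic character sum over the first or second quarter of the residues
(`sum_quadraticChar_quarters`). -/

/-- The quadratic character of a finite field with values in a commutative ring. -/
noncomputable def quadraticMulChar (F A : Type*) [Field F] [Fintype F] [CommRing A] :
    MulChar F A :=
  open Classical in (quadraticChar F).ringHomComp (Int.castRingHom A)

/-- The sum of the Jacobi sums of the quadratic character with `χ ^ k` and with `χ ^ (-k)`. -/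
noncomputable def jacobiPairSum {F A : Type*} [Field F] [Fintype F] [CommRing A]
    (χ : MulChar F A) (k : ℤ) : A :=
  jacobiSum (quadraticMulChar F A) (χ ^ k) + jacobiSum (quadraticMulChar F A) (χ ^ (-k))

/-- The natural numbers strictly between `0` and `n / 2`. -/
def halfRange (n : ℕ) : Finset ℕ := (range n).filter (fun k => 0 < k ∧ 2 * k < n)

lemma mem_halfRange {n k : ℕ} : k ∈ halfRange n ↔ 0 < k ∧ 2 * k < n := by
  simp only [halfRange, mem_filter, mem_range]
  omega

/-- The product of the paired Jacobi sums over `0 < k < n / 2`. -/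
noncomputable def jacobiPairProduct {F A : Type*} [Field F] [Fintype F] [CommRing A]
    (n : ℕ) (χ : MulChar F A) : A :=
  ∏ k ∈ halfRange n, jacobiPairSum χ (k : ℤ)

lemma jacobiProduct_eq_jacobiPairProduct {F K : Type*} [Field F] [Fintype F] [Field K] {n : ℕ}
    (hF : Fintype.card F = 2 * n + 1) (χ : MulChar F K) :
    jacobiProduct χ = jacobiPairProduct n χ := by
  unfold jacobiProduct jacobiPairProduct
  refine prod_congr ?_ fun k _ => rfl
  ext k
  simp only [mem_halfRange, mem_filter, mem_range, hF]
  omega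

/-! ### Base change of the Jacobi products along ring homomorphisms. -/

section RingHom
variable {F A B : Type*} [Field F] [Fintype F] [CommRing A] [CommRing B]

lemma quadraticMulChar_ringHomComp (f : A →+* B) :
    (quadraticMulChar F A).ringHomComp f = quadraticMulChar F B := by
  ext a
  simp [quadraticMulChar]

lemma map_jacobiPairSum (f : A →+* B) (χ : MulChar F A) (k : ℤ) :
    f (jacobiPairSum χ k) = jacobiPairSum (χ.ringHomComp f) k := by
  simp only [jacobiPairSum, map_add, MulChar.ringHomComp_zpow,
    ← quadraticMulChar_ringHomComp f, jacobiSum_ringHomComp]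

lemma map_jacobiPairProduct (f : A →+* B) (n : ℕ) (χ : MulChar F A) :
    f (jacobiPairProduct n χ) = jacobiPairProduct n (χ.ringHomComp f) := by
  simp only [jacobiPairProduct, map_prod, map_jacobiPairSum]

end RingHom

/-- The target is an arbitrary commutative ring so that a character can be built over
`ℤ[X]/(Φ_{2n})` as well as over `K`. -/
lemma MulChar.exists_apply_eq_of_pow_eq_one {F A : Type*} [Field F] [Fintype F] [CommRing A]
    {g : Fˣ} (hg : ∀ x, x ∈ Subgroup.zpowers g) {ζ : A} (hζ : ζ ^ (Fintype.card F - 1) = 1) :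
    ∃ χ : MulChar F A, χ g = ζ := by
  classical
  have hpos : Fintype.card F - 1 ≠ 0 := by
    have := Fintype.one_lt_card (α := F)
    omega
  let z : Aˣ := Units.ofPowEqOne ζ _ hζ hpos
  have hz : z ∈ rootsOfUnity (Fintype.card Fˣ) A := by
    rw [mem_rootsOfUnity, Fintype.card_units]
    exact Units.pow_ofPowEqOne hζ hpos
  exact ⟨MulChar.ofRootOfUnity hz hg, MulChar.ofRootOfUnity_spec hz hg⟩

/-! ### Symmetries of the paired Jacobi sums in the exponent. -/

section Symmetry
variable {F A : Type*} [Field F] [Fintype F] [CommRing A]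

lemma quadraticMulChar_apply [DecidableEq F] (a : F) :
    quadraticMulChar F A a = (quadraticChar F a : A) := by
  simp only [quadraticMulChar, MulChar.ringHomComp_apply, eq_intCast]
  congr!

lemma quadraticMulChar_inv_apply (a : F) :
    quadraticMulChar F A a⁻¹ = quadraticMulChar F A a := by
  classical
  rw [quadraticMulChar_apply, quadraticMulChar_apply, ← MulChar.inv_apply',
    (quadraticChar_isQuadratic F).inv]

lemma jacobiPairSum_neg (χ : MulChar F A) (k : ℤ) :
    jacobiPairSum χ (-k) = jacobiPairSum χ k := by
  simp only [jacobiPairSum, neg_neg]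
  exact add_comm _ _

/-- Substituting `x ↦ (1 - x)⁻¹` in the Jacobi sum. -/
lemma jacobiSum_quadraticMulChar_mul_inv (ψ : MulChar F A) :
    jacobiSum (quadraticMulChar F A) (quadraticMulChar F A * ψ⁻¹) =
      quadraticMulChar F A (-1) * jacobiSum (quadraticMulChar F A) ψ := by
  rw [jacobiSum_comm, jacobiSum, jacobiSum, mul_sum]
  symm
  -- Inversion with `0⁻¹ = 0` is a permutation of all of `F`; the point `x = 1` is then treated
  -- separately.
  refine sum_equiv ((Equiv.subLeft (1 : F)).trans (Equiv.inv F)) (by simp) fun x _ => ?_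
  simp only [Equiv.trans_apply, Equiv.subLeft_apply, Equiv.inv_apply, MulChar.mul_apply,
    MulChar.inv_apply', inv_inv]
  by_cases hx : 1 - x = 0
  · simp [hx, MulChar.map_zero]
  -- The key identity is `1 - (1 - x)⁻¹ = -x / (1 - x)`.
  have h : quadraticMulChar F A (1 - x)⁻¹ * quadraticMulChar F A (1 - (1 - x)⁻¹) =
      quadraticMulChar F A (-1) * quadraticMulChar F A x := by
    rw [quadraticMulChar_inv_apply, ← map_mul, ← map_mul]
    congr 1
    field_simp
    ring
  linear_combination -(ψ (1 - x)) * h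

/-- Since `χ^(k+n) = φ · (χ^(-k))⁻¹`, the substitution behind `jacobiSum_quadraticMulChar_mul_inv`
exchanges the two members of the pair, each at the cost of a factor `φ(-1)`. -/
lemma jacobiPairSum_add {χ : MulChar F A} {n : ℕ} (hχ : χ ^ n = quadraticMulChar F A) (k : ℤ) :
    jacobiPairSum χ (k + n) = quadraticMulChar F A (-1) * jacobiPairSum χ k := by
  have hinv : (quadraticMulChar F A)⁻¹ = quadraticMulChar F A :=
    by
    classical exact ((quadraticChar_isQuadratic F).comp _).inv
  have h1 : χ ^ (k + n) = quadraticMulChar F A * (χ ^ (-k))⁻¹ := by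
    rw [zpow_add, zpow_natCast, hχ, zpow_neg, inv_inv, mul_comm]
  have h2 : χ ^ (-(k + n)) = quadraticMulChar F A * (χ ^ k)⁻¹ := by
    rw [zpow_neg, zpow_add, zpow_natCast, hχ, mul_inv_rev, hinv]
  rw [jacobiPairSum, jacobiPairSum, h1, h2, jacobiSum_quadraticMulChar_mul_inv,
    jacobiSum_quadraticMulChar_mul_inv, zpow_neg]
  ring

lemma quadraticMulChar_neg_one_sq : quadraticMulChar F A (-1) ^ 2 = 1 := by
  rw [← map_pow, neg_one_sq, map_one]

/-- As `φ(-1) = (-1)^n` and `n(n+1)` is even. This is what makes `φ(-1)^|k| J_k` periodic modulo `n`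
for either parity of `n`. -/
lemma quadraticMulChar_neg_one_pow_succ {n : ℕ} (hF : Fintype.card F = 2 * n + 1) :
    quadraticMulChar F A (-1) ^ (n + 1) = 1 := by
  classical
  rcases Nat.even_or_odd' n with ⟨c, rfl | rfl⟩
  · have hsq : IsSquare (-1 : F) := by
      rw [FiniteField.isSquare_neg_one_iff]
      omega
    rw [quadraticMulChar_apply, (quadraticChar_one_iff_isSquare (by simp)).mpr hsq]
    simp
  · rw [show 2 * c + 1 + 1 = 2 * (c + 1) by ring, pow_mul, quadraticMulChar_neg_one_sq, one_pow]

end Symmetry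

/-! ### Invariance of the product under change of generator. -/

/-- Multiplication by a unit modulo `n` permutes the nonzero classes other than `n / 2` up to
sign. -/
lemma prod_halfRange_mul {A : Type*} [CommMonoid A] {n : ℕ} {t : ℤ → A}
    (hneg : ∀ k, t (-k) = t k) (hper : ∀ k, t (k + n) = t k) {a b : ℤ}
    (hab : (a : ZMod n) * b = 1) :
    ∏ k ∈ halfRange n, t (a * k) = ∏ k ∈ halfRange n, t k := by
  rcases Nat.eq_zero_or_pos n with rfl | hn
  · rfl
  have : NeZero n := ⟨hn.ne'⟩
  have hcong : ∀ x y : ℤ, (x : ZMod n) = y → t x = t y := by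
    intro x y hxy
    have hp : Function.Periodic t (n : ℤ) := hper
    obtain ⟨c, hc⟩ := (ZMod.intCast_eq_intCast_iff_dvd_sub x y n).mp hxy
    have := hp.int_mul c x
    rw [← this]
    congr 1
    push_cast
    linarith
  have hnat : ∀ z : ZMod n, ((z.valMinAbs.natAbs : ℕ) : ZMod n) = z ∨
      ((z.valMinAbs.natAbs : ℕ) : ZMod n) = -z := by
    intro z
    have hz := ZMod.coe_valMinAbs z
    rcases Int.natAbs_eq z.valMinAbs with h | h
    · left
      conv_rhs => rw [← hz, h]
      simp
    · right
      conv_rhs => rw [← hz, h]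
      simp
  -- The permutation sends `k` to the absolute value of the residue of `c * k` of least absolute
  -- value.
  let i : ℤ → ℕ → ℕ := fun c k => ((c : ZMod n) * (k : ZMod n)).valMinAbs.natAbs
  have hi_mem : ∀ c d : ℤ, (c : ZMod n) * d = 1 → ∀ k ∈ halfRange n, i c k ∈ halfRange n := by
    intro c d hcd k hk
    rw [mem_halfRange] at hk ⊢
    have hdc : (d : ZMod n) * c = 1 := by rw [mul_comm, hcd]
    have hle := ZMod.natAbs_valMinAbs_le ((c : ZMod n) * (k : ZMod n))
    have hne : ∀ m : ℕ, 0 < m → m < n → (m : ZMod n) ≠ 0 := by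
      intro m h0 h1 h
      rw [ZMod.natCast_eq_zero_iff] at h
      exact absurd (Nat.le_of_dvd h0 h) (by omega)
    constructor
    · refine Nat.pos_of_ne_zero fun h => ?_
      rw [Int.natAbs_eq_zero, ZMod.valMinAbs_eq_zero] at h
      refine hne k hk.1 (by omega) ?_
      calc (k : ZMod n) = d * (c * k) := by rw [← mul_assoc, hdc, one_mul]
        _ = 0 := by rw [h, mul_zero]
    -- The residue `n / 2` is not attained: it would give `2ck = 0`, hence `2k = 0` modulo `n`,
    -- against `0 < 2k < n`.
    · by_contra hcon
      have h2 : 2 * ((c : ZMod n) * (k : ZMod n)).valMinAbs.natAbs = n := by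
        have : 2 * (n / 2) ≤ n := Nat.mul_div_le n 2
        change ¬ 2 * ((c : ZMod n) * (k : ZMod n)).valMinAbs.natAbs < n at hcon
        omega
      have h3 : 2 * ((c : ZMod n) * (k : ZMod n)) = 0 := by
        have h4 : 2 * ((((c : ZMod n) * (k : ZMod n)).valMinAbs.natAbs : ℕ) : ZMod n) = 0 := by
          rw [← Nat.cast_ofNat, ← Nat.cast_mul, h2, ZMod.natCast_self]
        rcases hnat ((c : ZMod n) * (k : ZMod n)) with h | h
        · rw [← h, h4]
        · rwa [h, mul_neg, neg_eq_zero] at h4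
      refine hne (2 * k) (by omega) hk.2 ?_
      push_cast
      calc (2 * k : ZMod n) = d * (2 * (c * k)) := by
            linear_combination (-2 * k : ZMod n) * hdc
        _ = 0 := by rw [h3, mul_zero]
  have hi_inv : ∀ c d : ℤ, (c : ZMod n) * d = 1 → ∀ k ∈ halfRange n, i d (i c k) = k := by
    intro c d hcd k hk
    rw [mem_halfRange] at hk
    have hdc : (d : ZMod n) * c = 1 := by rw [mul_comm, hcd]
    have hk' : (k : ZMod n).valMinAbs = k := ZMod.valMinAbs_natCast_of_le_half (by omega)
    simp only [i]
    rcases hnat ((c : ZMod n) * (k : ZMod n)) with h | h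
    · rw [h, ← mul_assoc, hdc, one_mul, hk', Int.natAbs_natCast]
    · rw [h, mul_neg, ZMod.natAbs_valMinAbs_neg, ← mul_assoc, hdc, one_mul, hk',
        Int.natAbs_natCast]
  have hba : (b : ZMod n) * a = 1 := by rw [mul_comm, hab]
  refine prod_nbij' (i a) (i b) (hi_mem a b hab) (hi_mem b a hba) (hi_inv a b hab)
    (hi_inv b a hba) fun k hk => ?_
  have hv : t (a * k) = t ((a : ZMod n) * k).valMinAbs := by
    apply hcong
    rw [ZMod.coe_valMinAbs]
    push_cast
    rfl
  rw [hv]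
  rcases Int.natAbs_eq ((a : ZMod n) * k).valMinAbs with h | h
  · exact congrArg t h
  · rw [h, hneg]

section Invariance
variable {F A : Type*} [Field F] [Fintype F] [CommRing A]

/-- The twist `t k = φ(-1)^|k| J_k` is even and `n`-periodic, so `prod_halfRange_mul` applies to it.
Since `a` is odd, `a * k` and `k` have the same parity, and the twisting signs agree on both sides.
-/
lemma jacobiPairProduct_pow {χ : MulChar F A} {n : ℕ} (hF : Fintype.card F = 2 * n + 1)
    (hχ : χ ^ n = quadraticMulChar F A) {a : ℕ} (ha : a.Coprime (2 * n)) :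
    jacobiPairProduct n (χ ^ a) = jacobiPairProduct n χ := by
  set ε : A := quadraticMulChar F A (-1) with hε
  have hε2 : ε ^ 2 = 1 := quadraticMulChar_neg_one_sq
  have hodd : Odd a := (Nat.Coprime.coprime_mul_right_right ha).odd_of_right
  have hpar : ∀ k : ℤ, ε ^ (a * k).natAbs = ε ^ k.natAbs := by
    intro k
    obtain ⟨c, hc⟩ := hodd
    rw [Int.natAbs_mul, Int.natAbs_natCast, pow_mul, hc, pow_succ, pow_mul, hε2, one_pow, one_mul]
  let t : ℤ → A := fun k => ε ^ k.natAbs * jacobiPairSum χ k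
  have ht : ∀ k, jacobiPairSum χ k = ε ^ k.natAbs * t k := by
    intro k
    simp only [t]
    rw [← mul_assoc, ← pow_add, ← two_mul, pow_mul, hε2, one_pow, one_mul]
  have hεpow : ∀ x y : ℕ, x % 2 = y % 2 → ε ^ x = ε ^ y := by
    intro x y h
    rw [← Nat.mod_add_div x 2, ← Nat.mod_add_div y 2, pow_add, pow_add, pow_mul, pow_mul, hε2,
      one_pow, one_pow, h]
  have hneg : ∀ k, t (-k) = t k := by
    intro k
    simp only [t, jacobiPairSum_neg, Int.natAbs_neg]
  have hper : ∀ k, t (k + n) = t k := by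
    intro k
    simp only [t]
    rw [jacobiPairSum_add hχ, ← hε, ← mul_assoc, ← pow_succ]
    congr 1
    calc ε ^ ((k + n).natAbs + 1) = ε ^ (k.natAbs + (n + 1)) := hεpow _ _ (by omega)
      _ = ε ^ k.natAbs := by
        rw [pow_add, quadraticMulChar_neg_one_pow_succ hF, mul_one]
  obtain ⟨b, hb⟩ : ∃ b : ℤ, (((a : ℤ) : ZMod n)) * b = 1 := by
    have hcop : a.Coprime n := Nat.Coprime.coprime_mul_left_right ha
    refine ⟨((ZMod.unitOfCoprime a hcop)⁻¹ : (ZMod n)ˣ).val.cast, ?_⟩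
    rw [ZMod.intCast_cast, ZMod.cast_id', id, Int.cast_natCast,
      ← ZMod.coe_unitOfCoprime a hcop, Units.mul_inv]
  clear_value t
  calc jacobiPairProduct n (χ ^ a) = ∏ k ∈ halfRange n, ε ^ k * t (a * k) := by
        refine prod_congr rfl fun k _ => ?_
        have : jacobiPairSum (χ ^ a) k = jacobiPairSum χ (a * k) := by
          simp only [jacobiPairSum, ← zpow_natCast, ← zpow_mul, mul_neg]
        rw [this, ht, hpar, Int.natAbs_natCast]
    _ = ∏ k ∈ halfRange n, ε ^ k * t k := by
        rw [prod_mul_distrib, prod_mul_distrib, prod_halfRange_mul hneg hper hb]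
    _ = jacobiPairProduct n χ := by
        refine prod_congr rfl fun k _ => ?_
        rw [ht, Int.natAbs_natCast]

end Invariance

/-! ### Rationality of the product and its reduction to characteristic `p`. -/

/-- An integer polynomial of degree less than `φ N` that takes the same value at all primitive
`N`-th roots of unity is constant. -/
lemma Polynomial.eq_C_of_aeval_primitiveRoots_eq {K : Type*} [Field K] [CharZero K] {N : ℕ}
    {ζ : K} (hζ : IsPrimitiveRoot ζ N) {Q : Polynomial ℤ} {c : K}
    (hdeg : Q.degree < (N.totient : WithBot ℕ))
    (hQ : ∀ z : K, IsPrimitiveRoot z N → Q.eval₂ (Int.castRingHom K) z = c) :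
    Q = Polynomial.C (Q.coeff 0) := by
  have htot : (0 : WithBot ℕ) ≤ (N.totient : WithBot ℕ) := by exact_mod_cast Nat.zero_le _
  rcases Nat.eq_zero_or_pos N with rfl | hN
  · rw [Nat.totient_zero] at hdeg
    exact Polynomial.eq_C_of_degree_le_zero hdeg.le
  have htpos : 0 < N.totient := Nat.totient_pos.mpr hN
  have h : Q.map (Int.castRingHom K) = Polynomial.C c := by
    refine Polynomial.eq_of_degrees_lt_of_eval_finset_eq (primitiveRoots N K) ?_ ?_ ?_
    · rw [hζ.card_primitiveRoots]
      exact Polynomial.degree_map_le.trans_lt hdeg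
    · rw [hζ.card_primitiveRoots]
      exact Polynomial.degree_C_le.trans_lt (by exact_mod_cast htpos)
    · intro z hz
      rw [mem_primitiveRoots hN] at hz
      rw [Polynomial.eval_map, hQ z hz, Polynomial.eval_C]
  ext i
  have hi := congrArg (fun q => Polynomial.coeff q i) h
  simp only [Polynomial.coeff_map, Polynomial.coeff_C, eq_intCast] at hi
  rw [Polynomial.coeff_C]
  split_ifs with h0
  · rw [h0]
  · rw [if_neg h0] at hi
    exact_mod_cast hi

/-- The value of a generator of the character group at a generator of the unit group. -/
lemma IsCharGenerator.isPrimitiveRoot {F K : Type*} [Field F] [Fintype F] [Field K] {N : ℕ}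
    (hF : Fintype.card F = N + 1) {ζ : K} (hζ : IsPrimitiveRoot ζ N) {χ : MulChar F K}
    (hχ : IsCharGenerator χ) {g : Fˣ} (hg : ∀ x, x ∈ Subgroup.zpowers g) :
    IsPrimitiveRoot (χ g) N := by
  classical
  have hcard : Fintype.card Fˣ = N := by rw [Fintype.card_units, hF, Nat.add_sub_cancel]
  have hχN : χ g ^ N = 1 := by
    rw [← map_pow, ← Units.val_pow_eq_pow_val, ← hcard, pow_card_eq_one, Units.val_one, map_one]
  -- Some character takes the primitive root `ζ` at `g`. It is a power of `χ`, so the order of `χ g`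
  -- cannot be smaller than `N`.
  obtain ⟨ψ, hψ⟩ := MulChar.exists_apply_eq_of_pow_eq_one (A := K) hg (ζ := ζ)
    (by rw [hF, Nat.add_sub_cancel, hζ.pow_eq_one])
  obtain ⟨j, rfl⟩ := Subgroup.mem_zpowers_iff.mp (hχ ψ)
  refine ⟨hχN, fun l hl => hζ.dvd_of_pow_eq_one l ?_⟩
  have hl' : χ ((g ^ l : Fˣ) : F) = 1 := by rw [Units.val_pow_eq_pow_val, map_pow, hl]
  rw [← hψ, ← map_pow, ← Units.val_pow_eq_pow_val, MulChar.zpow_apply_coe]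
  have : χ.toUnitHom (g ^ l) = 1 := by
    ext
    rw [MulChar.coe_toUnitHom, hl', Units.val_one]
  rw [← MulChar.coe_toUnitHom, map_zpow, this, one_zpow, Units.val_one]

lemma ringChar_ne_two_of_card {F : Type*} [Field F] [Fintype F] {n : ℕ}
    (hF : Fintype.card F = 2 * n + 1) : ringChar F ≠ 2 := by
  intro h
  have := FiniteField.even_card_iff_char_two.mp h
  omega

lemma orderOf_eq_card_sub_one {F : Type*} [Field F] [Fintype F] {N : ℕ}
    (hF : Fintype.card F = N + 1) {g : Fˣ} (hg : ∀ x, x ∈ Subgroup.zpowers g) :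
    orderOf g = N := by
  classical
  rw [orderOf_eq_card_of_forall_mem_zpowers hg, Nat.card_eq_fintype_card, Fintype.card_units, hF,
    Nat.add_sub_cancel]

lemma quadraticChar_generator {F : Type*} [Field F] [Fintype F] [DecidableEq F] {n : ℕ}
    (hF : Fintype.card F = 2 * n + 1) {g : Fˣ} (hg : ∀ x, x ∈ Subgroup.zpowers g) :
    quadraticChar F g = -1 := by
  have hn : 0 < n := by
    have := Fintype.one_lt_card (α := F)
    omega
  refine (quadraticChar_dichotomy g.ne_zero).resolve_left fun h => ?_
  have hpow := quadraticChar_eq_pow_of_char_ne_two' (ringChar_ne_two_of_card hF) (g : F)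
  rw [h, hF, show (2 * n + 1) / 2 = n by omega, Int.cast_one] at hpow
  have h1 : g ^ n = 1 := by
    ext
    rw [Units.val_pow_eq_pow_val, ← hpow, Units.val_one]
  have := Nat.le_of_dvd hn (orderOf_dvd_of_pow_eq_one h1)
  rw [orderOf_eq_card_sub_one hF hg] at this
  omega

lemma pow_eq_quadraticMulChar {F K : Type*} [Field F] [Fintype F] [Field K] {n : ℕ}
    (hF : Fintype.card F = 2 * n + 1) {g : Fˣ} (hg : ∀ x, x ∈ Subgroup.zpowers g)
    {χ : MulChar F K} (hχ : IsPrimitiveRoot (χ g) (2 * n)) :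
    χ ^ n = quadraticMulChar F K := by
  classical
  have hn : 0 < n := by
    have := Fintype.one_lt_card (α := F)
    omega
  rw [MulChar.eq_iff hg, MulChar.pow_apply_coe, quadraticMulChar_apply,
    quadraticChar_generator hF hg, Int.cast_neg, Int.cast_one]
  have hsq : (χ g ^ n) ^ 2 = 1 := by rw [← pow_mul, mul_comm, hχ.pow_eq_one]
  exact (sq_eq_sq_iff_eq_or_eq_neg.mp (hsq.trans (one_pow 2).symm)).resolve_left
    (hχ.pow_ne_one_of_pos_of_lt hn.ne' (by omega))

/-- The product of paired Jacobi sums is a rational integer that is the same for all generators,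
and its reduction is the product attached to the identity character `ω` of `F`. -/
theorem exists_int_jacobiPairProduct {F K : Type*} [Field F] [Fintype F] [Field K] [CharZero K]
    [IsAlgClosed K] {n : ℕ} (hF : Fintype.card F = 2 * n + 1) :
    ∃ (R : ℤ) (ω : MulChar F F), (∀ χ : MulChar F K, IsCharGenerator χ →
      jacobiPairProduct n χ = (R : K)) ∧ (∀ x, ω x = x) ∧ jacobiPairProduct n ω = (R : F) := by
  classical
  have hn : 0 < n := by
    have := Fintype.one_lt_card (α := F)
    omega
  have hN : 0 < 2 * n := by omega
  obtain ⟨g, hg⟩ := IsCyclic.exists_generator (α := Fˣ)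
  have : NeZero (2 * n) := ⟨hN.ne'⟩
  have : NeZero ((2 * n : ℕ) : K) := ⟨by exact_mod_cast hN.ne'⟩
  obtain ⟨ζ, hζ⟩ := HasEnoughRootsOfUnity.exists_primitiveRoot K (2 * n)
  -- The ring `ℤ[X]/(Φ)` maps to `K` through any primitive root of unity and to `F` through a
  -- generator of `Fˣ`, so one computation there serves both.
  let Φ := Polynomial.cyclotomic (2 * n) ℤ
  have hr : AdjoinRoot.root Φ ^ (Fintype.card F - 1) = 1 := by
    rw [hF, Nat.add_sub_cancel, ← sub_eq_zero, ← AdjoinRoot.mk_X, ← map_pow, ← map_one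
      (AdjoinRoot.mk Φ), ← map_sub, AdjoinRoot.mk_eq_zero]
    exact Polynomial.cyclotomic.dvd_X_pow_sub_one _ _
  obtain ⟨χA, hχA⟩ := MulChar.exists_apply_eq_of_pow_eq_one hg hr
  obtain ⟨P, hP⟩ := AdjoinRoot.mk_surjective (jacobiPairProduct n χA)
  have hmonic : Φ.Monic := Polynomial.cyclotomic.monic _ _
  have hQ : AdjoinRoot.mk Φ (P %ₘ Φ) = jacobiPairProduct n χA := by
    rw [← hP, AdjoinRoot.mk_eq_mk, Polynomial.modByMonic_eq_sub_mul_div P Φ]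
    exact ⟨-(P /ₘ Φ), by ring⟩
  have hdeg : (P %ₘ Φ).degree < ((2 * n).totient : WithBot ℕ) := by
    rw [← Polynomial.degree_cyclotomic (2 * n) ℤ]
    exact Polynomial.degree_modByMonic_lt P hmonic
  have hroot : ∀ {z : K}, IsPrimitiveRoot z (2 * n) → Φ.eval₂ (Int.castRingHom K) z = 0 := by
    intro z hz
    rw [← Polynomial.eval_map, Polynomial.map_cyclotomic]
    exact hz.isRoot_cyclotomic hN
  have hlift : ∀ {z : K} (hz : IsPrimitiveRoot z (2 * n)) {χ : MulChar F K}, χ g = z →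
      χA.ringHomComp (AdjoinRoot.lift (Int.castRingHom K) z (hroot hz)) = χ := by
    intro z hz χ hχ
    rw [MulChar.eq_iff hg, MulChar.ringHomComp_apply, hχA, AdjoinRoot.lift_root, hχ]
  obtain ⟨χ₀, hχ₀⟩ := MulChar.exists_apply_eq_of_pow_eq_one (A := K) hg (ζ := ζ)
    (by rw [hF, Nat.add_sub_cancel, hζ.pow_eq_one])
  -- The value at another primitive root `ζ^a` is the product for `χ₀^a`, which invariance
  -- identifies with the one for `χ₀`.
  have hindep : ∀ z : K, IsPrimitiveRoot z (2 * n) →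
      (P %ₘ Φ).eval₂ (Int.castRingHom K) z = jacobiPairProduct n χ₀ := by
    intro z hz
    obtain ⟨a, -, ha, rfl⟩ := (hζ.isPrimitiveRoot_iff).mp hz
    have hχa : (χ₀ ^ a) g = ζ ^ a := by rw [MulChar.pow_apply_coe, hχ₀]
    rw [← AdjoinRoot.lift_mk (hroot hz), hQ, map_jacobiPairProduct, hlift hz hχa]
    exact jacobiPairProduct_pow hF (pow_eq_quadraticMulChar hF hg (by rwa [hχ₀])) ha
  have hconst := Polynomial.eq_C_of_aeval_primitiveRoots_eq hζ hdeg hindep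
  set R := (P %ₘ Φ).coeff 0
  have hA : jacobiPairProduct n χA = (R : AdjoinRoot Φ) := by
    rw [← hQ, hconst]
    simp
  -- `g` has exact order `2n` in `Fˣ`, hence is a root of the reduced cyclotomic polynomial.
  have hrootF : Φ.eval₂ (Int.castRingHom F) (g : F) = 0 := by
    rw [← Polynomial.eval_map, Polynomial.map_cyclotomic]
    have hg' : IsPrimitiveRoot (g : F) (2 * n) := by
      rw [IsPrimitiveRoot.coe_units_iff, ← orderOf_eq_card_sub_one hF hg]
      exact IsPrimitiveRoot.orderOf g
    exact hg'.isRoot_cyclotomic hN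
  let π := AdjoinRoot.lift (Int.castRingHom F) (g : F) hrootF
  refine ⟨R, χA.ringHomComp π, fun χ hχ => ?_, fun x => ?_, ?_⟩
  · have hz := hχ.isPrimitiveRoot hF hζ hg
    rw [← hlift hz rfl, ← map_jacobiPairProduct, hA, map_intCast]
  · rcases eq_or_ne x 0 with rfl | hx
    · exact MulChar.map_zero _
    · obtain ⟨j, hj⟩ := Subgroup.mem_zpowers_iff.mp (hg (Units.mk0 x hx))
      have h1 : (χA.ringHomComp π).toUnitHom g = g := by
        ext
        rw [MulChar.coe_toUnitHom, MulChar.ringHomComp_apply, hχA, AdjoinRoot.lift_root]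
      have h2 : (χA.ringHomComp π).toUnitHom (Units.mk0 x hx) = Units.mk0 x hx := by
        rw [← hj, map_zpow, h1]
      simpa only [MulChar.coe_toUnitHom, Units.val_mk0] using congrArg Units.val h2
  · rw [← map_jacobiPairProduct, hA, map_intCast]

/-! ### Jacobi sums of the identity character as binomial coefficients. -/

section Reduction
variable {F : Type*} [Field F] [Fintype F]

/-- For positive exponents only multiples of `q - 1 = N` contribute, and `N` is the only one in this
range. -/
lemma FiniteField.sum_pow_lt_two_mul {N : ℕ} (hF : Fintype.card F = N + 1) {e : ℕ} (h0 : 0 < e)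
    (h1 : e < 2 * N) : ∑ x : F, x ^ e = if e = N then -1 else 0 := by
  classical
  rcases lt_trichotomy e N with h | rfl | h
  · rw [if_neg h.ne]
    exact FiniteField.sum_pow_lt_card_sub_one F e (by omega)
  · rw [if_pos rfl]
    have hunits := FiniteField.sum_pow_units F e
    rw [hF, Nat.add_sub_cancel, if_pos dvd_rfl] at hunits
    have hsplit : ∑ x : F, x ^ e = ∑ x : Fˣ, (x : F) ^ e + (0 : F) ^ e := by
      rw [Fintype.sum_eq_add_sum_subtype_ne _ (0 : F), add_comm]
      exact congrArg (· + _) (Fintype.sum_equiv unitsEquivNeZero _ _ fun x => rfl).symm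
    rw [hsplit, zero_pow h0.ne', add_zero, ← hunits]
  · rw [if_neg h.ne']
    have hred : ∀ x : F, x ^ e = x ^ (e - N) := by
      intro x
      obtain ⟨d, rfl⟩ : ∃ d, e = N + 1 + d := ⟨e - (N + 1), by omega⟩
      rw [pow_add, ← hF, FiniteField.pow_card, hF, ← pow_succ']
      congr 1
      omega
    rw [sum_congr rfl fun x _ => hred x]
    exact FiniteField.sum_pow_lt_card_sub_one F _ (by omega)

variable {n : ℕ} (hF : Fintype.card F = 2 * n + 1)
include hF

lemma quadraticMulChar_self_apply (x : F) : quadraticMulChar F F x = x ^ n := by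
  classical
  rw [quadraticMulChar_apply,
    quadraticChar_eq_pow_of_char_ne_two' (ringChar_ne_two_of_card hF), hF,
    show (2 * n + 1) / 2 = n by omega]

/-- Here `φ(x) = x^n`. Expanding `x^n (1 - x)^j` and summing over `F`, only the exponent `n + i =
2n` survives, which picks out the coefficient `i = n`. -/
lemma jacobiSum_identityChar_pow {ω : MulChar F F} (hω : ∀ x, ω x = x) {j : ℕ} (h0 : 0 < j)
    (hj : j < 2 * n) :
    jacobiSum (quadraticMulChar F F) (ω ^ j) = -(-1) ^ n * (j.choose n : F) := by
  have hn : 0 < n := by omega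
  have hexp : ∀ x : F, x ^ n * (1 - x) ^ j =
      ∑ i ∈ range (j + 1), (-1) ^ i * (j.choose i : F) * x ^ (n + i) := by
    intro x
    rw [sub_eq_neg_add, add_pow, mul_sum]
    refine sum_congr rfl fun i _ => ?_
    rw [one_pow, neg_pow, pow_add]
    ring
  calc jacobiSum (quadraticMulChar F F) (ω ^ j)
      = ∑ x : F, ∑ i ∈ range (j + 1), (-1) ^ i * (j.choose i : F) * x ^ (n + i) := by
        refine sum_congr rfl fun x _ => ?_
        rw [quadraticMulChar_self_apply hF, MulChar.pow_apply' _ h0.ne', hω, hexp]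
    _ = ∑ i ∈ range (j + 1), (-1) ^ i * (j.choose i : F) * (if i = n then -1 else 0) := by
        rw [sum_comm]
        refine sum_congr rfl fun i hi => ?_
        rw [mem_range] at hi
        rw [← mul_sum, FiniteField.sum_pow_lt_two_mul hF (by omega) (by omega)]
        congr 2
        exact propext (by omega)
    _ = -(-1) ^ n * (j.choose n : F) := by
        simp only [mul_ite, mul_zero, sum_ite_eq', mem_range]
        split_ifs with h
        · ring
        · rw [Nat.choose_eq_zero_of_lt (by omega)]
          simp

/-- The sum with `ω^k` contributes `C(k, n) = 0`; only `ω^(-k) = ω^(2n-k)` remains. -/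
lemma jacobiPairSum_identityChar {ω : MulChar F F} (hω : ∀ x, ω x = x) {k : ℕ} (h0 : 0 < k)
    (hk : k < n) :
    jacobiPairSum ω (k : ℤ) = -(-1) ^ n * ((2 * n - k).choose n : F) := by
  classical
  have hcard : ω ^ (2 * n) = 1 := by
    have := MulChar.pow_card_eq_one ω
    rwa [Fintype.card_units, hF, Nat.add_sub_cancel] at this
  have hneg : ω ^ (-(k : ℤ)) = ω ^ (2 * n - k) := by
    rw [zpow_neg, zpow_natCast, inv_eq_iff_mul_eq_one, ← pow_add,
      Nat.add_sub_cancel' (by omega), hcard]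
  rw [jacobiPairSum, hneg, zpow_natCast, jacobiSum_identityChar_pow hF hω h0 (by omega),
    jacobiSum_identityChar_pow hF hω (by omega) (by omega), Nat.choose_eq_zero_of_lt hk]
  simp

lemma jacobiPairProduct_identityChar {ω : MulChar F F} (hω : ∀ x, ω x = x) :
    jacobiPairProduct n ω = ∏ k ∈ halfRange n, (-(-1) ^ n * ((2 * n - k).choose n : F)) := by
  refine prod_congr rfl fun k hk => ?_
  rw [mem_halfRange] at hk
  exact jacobiPairSum_identityChar hF hω hk.1 (by omega)

end Reduction

/-! ### Vanishing modulo `p` over proper extensions, by Lucas. -/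

/-- Over a proper extension of the prime field with `q ≠ 9` one of the binomial coefficients is
divisible by `p`. -/
lemma exists_choose_modEq_zero {p f n : ℕ} [Fact p.Prime] (hp : p ≠ 2) (hf : 1 < f)
    (h9 : p ^ f ≠ 9) (hn : p ^ f = 2 * n + 1) :
    ∃ k ∈ halfRange n, p ∣ (2 * n - k).choose n := by
  have hprime : p.Prime := Fact.out
  obtain ⟨h, rfl⟩ : ∃ h, p = 2 * h + 1 := (hprime.eq_two_or_odd'.resolve_left hp)
  have hh : 0 < h := by
    have := hprime.two_le
    omega
  obtain ⟨e, rfl⟩ : ∃ e, f = e + 1 := ⟨f - 1, by omega⟩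
  -- This says exactly that `k = h + 1` satisfies `2k < n`; the inequality becomes an equality at `q
  -- = 9`.
  have hbig : 2 * (2 * h + 1) + 3 < (2 * h + 1) ^ (e + 1) := by
    rcases Nat.lt_or_ge 1 h with h1 | h1
    · calc 2 * (2 * h + 1) + 3 < (2 * h + 1) ^ 2 := by nlinarith
        _ ≤ (2 * h + 1) ^ (e + 1) := Nat.pow_le_pow_right (by omega) (by omega)
    · obtain rfl : h = 1 := by omega
      have he : 2 ≤ e := by
        by_contra hcon
        obtain rfl : e = 1 := by omega
        exact h9 (by norm_num)
      calc 2 * (2 * 1 + 1) + 3 < (2 * 1 + 1) ^ 3 := by norm_num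
        _ ≤ (2 * 1 + 1) ^ (e + 1) := Nat.pow_le_pow_right (by omega) (by omega)
  obtain ⟨u, hu⟩ : Odd ((2 * h + 1) ^ e) := Odd.pow ⟨h, rfl⟩
  have hpe : (2 * h + 1) ^ (e + 1) = (2 * u + 1) * (2 * h + 1) := by rw [pow_succ, hu]
  have hnu : n = h + (2 * h + 1) * u := by
    have : 2 * n + 1 = 2 * (h + (2 * h + 1) * u) + 1 := by rw [← hn, hpe]; ring
    omega
  -- In base `p = 2h + 1` the last digit of `n` is `h`, while that of `2n - (h + 1)` is `h - 1`, so
  -- the last Lucas factor is `C(h - 1, h) = 0`.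
  refine ⟨h + 1, ?_, ?_⟩
  · rw [mem_halfRange]
    omega
  · have hlow : 2 * n - (h + 1) = (h - 1) + (2 * h + 1) * (2 * u) := by
      have : 2 * n = 2 * h + (2 * h + 1) * (2 * u) := by rw [hnu]; ring
      omega
    have hluc := Choose.choose_modEq_choose_mod_mul_choose_div_nat (n := 2 * n - (h + 1)) (k := n)
      (p := 2 * h + 1)
    rw [← Nat.modEq_zero_iff_dvd]
    refine hluc.trans ?_
    have h1 : (2 * n - (h + 1)) % (2 * h + 1) = h - 1 := by
      rw [hlow, Nat.add_mul_mod_self_left, Nat.mod_eq_of_lt (by omega)]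
    have h2 : n % (2 * h + 1) = h := by
      rw [hnu, Nat.add_mul_mod_self_left, Nat.mod_eq_of_lt (by omega)]
    rw [h1, h2, Nat.choose_eq_zero_of_lt (by omega), zero_mul]

/-! ### Binomial congruences modulo `p = 2n + 1`. -/

lemma two_mul_add_one_eq_zero_of_eq {p n : ℕ} (hn : p = 2 * n + 1) :
    (2 * n + 1 : ZMod p) = 0 := by
  exact_mod_cast (ZMod.natCast_eq_zero_iff (2 * n + 1) p).mpr (dvd_of_eq hn)

/-- Modulo `p = 2n + 1`, the binomial coefficient `C(n, k)` is `C(-1/2, k)`. -/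
lemma neg_four_pow_mul_choose {p n : ℕ} [Fact p.Prime] (hn : p = 2 * n + 1) {k : ℕ}
    (hk : k ≤ n) : (-4 : ZMod p) ^ k * (n.choose k : ZMod p) = ((2 * k).choose k : ZMod p) := by
  induction k with
  | zero => simp
  | succ k ih =>
    have hk1 : ((k + 1 : ℕ) : ZMod p) ≠ 0 := by
      rw [Ne, ZMod.natCast_eq_zero_iff]
      exact fun h => absurd (Nat.le_of_dvd (by omega) h) (by omega)
    have h1 : (n.choose (k + 1) : ZMod p) * ((k + 1 : ℕ) : ZMod p) =
        n.choose k * ((n : ZMod p) - k) := by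
      rw [← Nat.cast_sub (by omega)]
      exact_mod_cast congrArg (Nat.cast (R := ZMod p)) (Nat.choose_succ_right_eq n k)
    have h2 : ((k + 1 : ℕ) : ZMod p) * ((2 * (k + 1)).choose (k + 1) : ZMod p) =
        2 * (2 * k + 1) * ((2 * k).choose k : ZMod p) := by
      exact_mod_cast congrArg (Nat.cast (R := ZMod p)) (Nat.succ_mul_centralBinom_succ k)
    have h3 := two_mul_add_one_eq_zero_of_eq hn
    refine mul_left_cancel₀ hk1 ?_
    rw [h2, ← ih (by omega), pow_succ]
    linear_combination (-4 : ZMod p) ^ k * (-4) * h1 - (-4 : ZMod p) ^ k * 2 * n.choose k * h3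

/-- Both sides obey the same recursion in `k` once `2n + 1 = 0`. The base case is `C(2n, n) = (-4)^n
= (-1)^n`, by Fermat's `4^n = 2^(p-1) = 1`. -/
lemma choose_two_mul_sub {p n : ℕ} [Fact p.Prime] (hn : p = 2 * n + 1) {k : ℕ} (hk : k ≤ n) :
    ((2 * n - k).choose n : ZMod p) = (-1) ^ n * (-1) ^ k * (n.choose k : ZMod p) := by
  have h3 := two_mul_add_one_eq_zero_of_eq hn
  induction k with
  | zero =>
    have h2 : (2 : ZMod p) ≠ 0 := fun h => by
      rw [h] at h3
      simp at h3
    have hfermat : (4 : ZMod p) ^ n = 1 := by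
      have := ZMod.pow_card_sub_one_eq_one h2
      rw [show p - 1 = 2 * n by omega, pow_mul] at this
      rw [← this]
      norm_num
    have := neg_four_pow_mul_choose hn le_rfl
    rw [Nat.choose_self, neg_pow, hfermat] at this
    rw [Nat.sub_zero, ← this]
    simp
  | succ k ih =>
    have hk1 : ((k + 1 : ℕ) : ZMod p) ≠ 0 := by
      rw [Ne, ZMod.natCast_eq_zero_iff]
      exact fun h => absurd (Nat.le_of_dvd (by omega) h) (by omega)
    have h1 : (n.choose (k + 1) : ZMod p) * ((k + 1 : ℕ) : ZMod p) =
        n.choose k * ((n : ZMod p) - k) := by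
      rw [← Nat.cast_sub (by omega)]
      exact_mod_cast congrArg (Nat.cast (R := ZMod p)) (Nat.choose_succ_right_eq n k)
    have h2 := congrArg (Nat.cast (R := ZMod p)) (Nat.choose_mul_succ_eq (2 * n - (k + 1)) n)
    rw [show 2 * n - (k + 1) + 1 = 2 * n - k by omega, show 2 * n - k - n = n - k by omega] at h2
    push_cast [Nat.cast_sub (show k ≤ 2 * n by omega), Nat.cast_sub (show k ≤ n by omega)] at h2
    rw [ih (by omega)] at h2
    refine mul_left_cancel₀ hk1 ?_
    push_cast at h1 ⊢
    linear_combination ((2 * n - (k + 1)).choose n : ZMod p) * h3 - h2 + (-1) ^ n * (-1) ^ k * h1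

/-! ### Exact evaluation for `q = 9`. -/

section Nine
variable {F K : Type*} [Field F] [Fintype F] [Field K]

lemma exists_isCharGenerator [CharZero K] [IsAlgClosed K] {N : ℕ}
    (hF : Fintype.card F = N + 1) : ∃ χ : MulChar F K, IsCharGenerator χ ∧ ∀ x, χ x = 1 → x = 1 := by
  classical
  have hN : 0 < N := by
    have := Fintype.one_lt_card (α := F)
    omega
  obtain ⟨g, hg⟩ := IsCyclic.exists_generator (α := Fˣ)
  have : NeZero N := ⟨hN.ne'⟩
  have : NeZero (N : K) := ⟨by exact_mod_cast hN.ne'⟩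
  obtain ⟨ζ, hζ⟩ := HasEnoughRootsOfUnity.exists_primitiveRoot K N
  obtain ⟨χ, hχ⟩ := MulChar.exists_apply_eq_of_pow_eq_one (A := K) hg (ζ := ζ)
    (by rw [hF, Nat.add_sub_cancel, hζ.pow_eq_one])
  have hgN : g ^ N = 1 := by
    rw [← orderOf_eq_card_sub_one hF hg, pow_orderOf_eq_one]
  refine ⟨χ, fun ψ => ?_, fun x hx => ?_⟩
  · have hψ : ψ g ^ N = 1 := by
      rw [← map_pow, ← Units.val_pow_eq_pow_val, hgN, Units.val_one, map_one]
    obtain ⟨i, -, hi⟩ := hζ.eq_pow_of_pow_eq_one hψ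
    refine Subgroup.mem_zpowers_iff.mpr ⟨i, ?_⟩
    rw [MulChar.eq_iff hg, zpow_natCast, MulChar.pow_apply_coe, hχ, hi]
  · have hx0 : x ≠ 0 := by
      rintro rfl
      rw [MulChar.map_zero] at hx
      exact zero_ne_one hx
    obtain ⟨i, hi⟩ := (mem_powers_iff_mem_zpowers (x := g) (y := Units.mk0 x hx0)).mpr (hg _)
    have hxi : (g : F) ^ i = x := by simpa using congrArg Units.val hi
    rw [← hxi, map_pow, hχ] at hx
    obtain ⟨c, rfl⟩ := hζ.dvd_of_pow_eq_one i hx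
    rw [← hxi, ← Units.val_pow_eq_pow_val, pow_mul, hgN, one_pow, Units.val_one]

/-- Cubing permutes `F` and fixes `φ(1 - x)`, so with `c = χ + χ⁻¹` twice the sum is `∑ φ(1 - x)
(c(x) + c(x³))`. The bracket vanishes unless `x² = 1`, `x = 1` is killed by `φ(0) = 0`, and `x = -1`
gives `-4`. -/
lemma jacobiPairSum_one_of_card_eq_nine [CharZero K] (hF : Fintype.card F = 9) {χ : MulChar F K}
    (hχ : ∀ x, χ x = 1 → x = 1) : jacobiPairSum χ 1 = -2 := by
  classical
  have : Fact (Nat.Prime 3) := ⟨Nat.prime_three⟩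
  have : CharP F 3 := charP_of_card_eq_prime_pow (f := 2) (by rw [hF]; norm_num)
  have h3 : (3 : F) = 0 := by exact_mod_cast CharP.cast_eq_zero F 3
  have hne : (-1 : F) ≠ 1 := by
    intro h
    have : (2 : F) = 0 := by linear_combination -h
    exact one_ne_zero (α := F) (by linear_combination h3 - this)
  set φ := quadraticMulChar F K with hφ
  -- `c 0 = 0`, because `χ 0 = 0` and `0⁻¹ = 0`.
  let c : F → K := fun x => χ x + (χ x)⁻¹
  have hsum : jacobiPairSum χ 1 = ∑ x, φ (1 - x) * c x := by
    rw [jacobiPairSum, jacobiSum_comm, jacobiSum_comm (quadraticMulChar F K) (χ ^ (-1 : ℤ)),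
      jacobiSum, jacobiSum, ← sum_add_distrib]
    refine sum_congr rfl fun x _ => ?_
    rw [zpow_one, zpow_neg, zpow_one, MulChar.inv_apply_eq_inv']
    ring
  have hcube : ∀ x : F, φ (1 - x ^ 3) = φ (1 - x) := by
    intro x
    have h : (1 - x) ^ 3 = 1 - x ^ 3 := by
      rw [sub_pow_char, one_pow]
    rw [← h, map_pow, hφ, quadraticMulChar_apply]
    rcases quadraticChar_isQuadratic F (1 - x) with h | h | h <;> rw [h] <;> norm_num
  have hfrob : ∑ x, φ (1 - x) * c x = ∑ x, φ (1 - x) * c (x ^ 3) := by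
    have hbij : Function.Bijective (frobenius F 3) :=
      Finite.injective_iff_bijective.mp (frobenius_inj F 3)
    rw [← hbij.sum_comp]
    refine sum_congr rfl fun x _ => ?_
    rw [frobenius_def, hcube]
  have hneg : χ (-1) = -1 := by
    have hsq : χ (-1) ^ 2 = 1 ^ 2 := by rw [← map_pow, neg_one_sq, map_one, one_pow]
    exact (sq_eq_sq_iff_eq_or_eq_neg.mp hsq).resolve_left fun h => hne (hχ _ h)
  have hφ2 : φ 2 = 1 := by
    have hsq : IsSquare (-1 : F) := by
      rw [FiniteField.isSquare_neg_one_iff, hF]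
      norm_num
    rw [show (2 : F) = -1 by linear_combination h3, hφ, quadraticMulChar_apply,
      (quadraticChar_one_iff_isSquare (by simp)).mpr hsq, Int.cast_one]
  have hterm : ∀ x, φ (1 - x) * c x + φ (1 - x) * c (x ^ 3) = if x = -1 then -4 else 0 := by
    intro x
    split_ifs with hx
    · rw [hx, show (1 - -1 : F) = 2 by norm_num, hφ2]
      simp only [c, map_pow, hneg]
      norm_num
    · rcases eq_or_ne x 0 with rfl | hx0
      · simp [c, MulChar.map_zero]
      · have h8 : χ x ^ 8 = 1 := by
          have := FiniteField.pow_card_sub_one_eq_one x hx0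
          rw [hF] at this
          rw [← map_pow, this, map_one]
        have hz0 : χ x ≠ 0 := fun h => by simp [h] at h8
        by_cases hz : χ x ^ 2 = 1
        · rw [← map_pow] at hz
          rcases sq_eq_sq_iff_eq_or_eq_neg.mp ((hχ _ hz).trans (one_pow 2).symm) with h | h
          · simp [h, MulChar.map_zero]
          · exact absurd h hx
        -- With `z = χ x`, `z⁸ - 1 = (z² - 1)(1 + z²)(1 + z⁴)` and `z³ (c(x) + c(x³)) = (1 + z²)(1 +
        -- z⁴)`.
        · have hfac : (1 + χ x ^ 2) * (1 + χ x ^ 4) = 0 := by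
            refine (mul_eq_zero.mp (?_ : (χ x ^ 2 - 1) * _ = 0)).resolve_left (sub_ne_zero.mpr hz)
            linear_combination h8
          have hd : c x + c (x ^ 3) = 0 := by
            simp only [c, map_pow]
            field_simp
            linear_combination hfac
          rw [← mul_add, hd, mul_zero]
  have htwo : 2 * jacobiPairSum χ 1 = -4 := by
    rw [two_mul]
    conv_lhs => rw [hsum]
    conv_lhs => arg 2; rw [hfrob]
    rw [← sum_add_distrib, sum_congr rfl fun x _ => hterm x]
    simp
  have h2 : (2 : K) ≠ 0 := two_ne_zero
  refine mul_left_cancel₀ h2 ?_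
  rw [htwo]
  norm_num

end Nine

lemma prod_halfRange {A : Type*} [CommMonoid A] (n : ℕ) (u : ℕ → A) :
    ∏ k ∈ halfRange n, u k = ∏ k ∈ range ((n - 1) / 2), u (k + 1) := by
  symm
  refine prod_nbij' (· + 1) (· - 1) ?_ ?_ ?_ ?_ ?_ <;>
    simp only [mem_halfRange, mem_range] <;> intros <;> first | omega | trivial

/-! ### Half rows of binomials and superfactorials modulo squares. -/

section Factorials
open Nat

/-- Multiply `C(2M, k) k! (2M-k)! = (2M)!` over `k < M`: the factorials on the left fill the
superfactorial except for its middle term `M!`. -/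
lemma prod_range_choose_two_mul (M : ℕ) :
    (∏ k ∈ range M, (2 * M).choose k) * ∏ j ∈ range (2 * M + 1), j ! = (2 * M)! ^ M * M ! := by
  have h : ∏ j ∈ range (2 * M + 1), j ! =
      ((∏ k ∈ range M, k !) * M !) * ∏ k ∈ range M, (2 * M - k)! := by
    rw [show 2 * M + 1 = M + 1 + M by ring, prod_range_add, prod_range_succ,
      ← prod_range_reflect (fun k => (2 * M - k)!)]
    congr 1
    refine prod_congr rfl fun k hk => ?_
    rw [mem_range] at hk
    congr 1
    omega
  calc _ = (∏ k ∈ range M, (2 * M).choose k * k ! * (2 * M - k)!) * M ! := by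
        rw [h, prod_mul_distrib, prod_mul_distrib]
        ring
    _ = (2 * M)! ^ M * M ! := by
        congr 1
        rw [prod_congr rfl (g := fun _ => (2 * M)!), prod_const, card_range]
        intro k hk
        rw [mem_range] at hk
        exact Nat.choose_mul_factorial_mul_factorial (by omega)

/-- An odd row has no middle term: `k!` and `(2m+1-k)!` for `k ≤ m` fill the superfactorial up to
`(2m+1)!`, one copy of which is cancelled. -/
lemma prod_range_choose_two_mul_add_one (m : ℕ) :
    (∏ k ∈ range (m + 1), (2 * m + 1).choose k) * ∏ j ∈ range (2 * m + 1), j ! =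
      (2 * m + 1)! ^ m := by
  have h : (∏ j ∈ range (2 * m + 1), j !) * (2 * m + 1)! =
      (∏ k ∈ range (m + 1), k !) * ∏ k ∈ range (m + 1), (2 * m + 1 - k)! := by
    rw [← prod_range_succ, show 2 * m + 1 + 1 = (m + 1) + (m + 1) by ring, prod_range_add,
      ← prod_range_reflect (fun k => (2 * m + 1 - k)!)]
    congr 1
    refine prod_congr rfl fun k hk => ?_
    rw [mem_range] at hk
    congr 1
    omega
  refine Nat.eq_of_mul_eq_mul_right (Nat.factorial_pos (2 * m + 1)) ?_
  calc _ = ∏ k ∈ range (m + 1), (2 * m + 1).choose k * k ! * (2 * m + 1 - k)! := by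
        rw [mul_assoc, h, prod_mul_distrib, prod_mul_distrib]
        ring
    _ = (2 * m + 1)! ^ m * (2 * m + 1)! := by
        rw [← pow_succ, prod_congr rfl (g := fun _ => (2 * m + 1)!), prod_const, card_range]
        intro k hk
        rw [mem_range] at hk
        exact Nat.choose_mul_factorial_mul_factorial (by omega)

variable {p : ℕ} [Fact p.Prime]

lemma factorial_ne_zero_zmod {a : ℕ} (ha : a < p) : ((a ! : ℕ) : ZMod p) ≠ 0 := by
  rw [Ne, ZMod.natCast_eq_zero_iff, (Fact.out : p.Prime).dvd_factorial]
  omega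

/-- Modulo squares `(2j-1)! (2j)! = (2j-1)!² · 2j` is `2j`, and these multiply to `2^M M!`. -/
lemma quadraticChar_superfactorial (M : ℕ) (hM : 2 * M < p) :
    quadraticChar (ZMod p) ((∏ j ∈ range (2 * M + 1), j ! : ℕ) : ZMod p) =
      quadraticChar (ZMod p) 2 ^ M * quadraticChar (ZMod p) ((M ! : ℕ) : ZMod p) := by
  induction M with
  | zero => simp
  | succ M ih =>
    have h : ∏ j ∈ range (2 * (M + 1) + 1), j ! =
        (∏ j ∈ range (2 * M + 1), j !) * ((2 * M + 1)! ^ 2 * (2 * (M + 1))) := by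
      rw [show 2 * (M + 1) + 1 = 2 * M + 1 + 1 + 1 by ring, prod_range_succ, prod_range_succ,
        Nat.factorial_succ (2 * M + 1)]
      ring
    rw [h, Nat.cast_mul, map_mul, ih (by omega), Nat.cast_mul, map_mul, Nat.cast_pow,
      quadraticChar_sq_one' (factorial_ne_zero_zmod (by omega)), Nat.factorial_succ, Nat.cast_mul,
      map_mul, Nat.cast_mul, map_mul, pow_succ]
    push_cast
    ring

lemma quadraticChar_prod_choose_two_mul {M : ℕ} (hM : 2 * M < p) (hp : p ≠ 2) :
    quadraticChar (ZMod p) ((∏ k ∈ range M, (2 * M).choose k : ℕ) : ZMod p) =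
      (quadraticChar (ZMod p) (((2 * M)! : ℕ) : ZMod p) * quadraticChar (ZMod p) 2) ^ M := by
  have h := congrArg (fun a : ℕ => quadraticChar (ZMod p) (a : ZMod p))
    (prod_range_choose_two_mul M)
  simp only [Nat.cast_mul, map_mul, Nat.cast_pow, map_pow] at h
  rw [quadraticChar_superfactorial M hM] at h
  have hfac : quadraticChar (ZMod p) ((M ! : ℕ) : ZMod p) ≠ 0 := by
    rw [Ne, quadraticChar_eq_zero_iff]
    exact factorial_ne_zero_zmod (by omega)
  rw [← mul_assoc] at h
  have h' := mul_right_cancel₀ hfac h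
  have h2 : quadraticChar (ZMod p) 2 ^ 2 = 1 := by
    refine quadraticChar_sq_one fun h0 => hp ?_
    have : p ∣ 2 := (ZMod.natCast_eq_zero_iff 2 p).mp (by exact_mod_cast h0)
    exact (Nat.prime_dvd_prime_iff_eq Fact.out Nat.prime_two).mp this
  rw [mul_pow, ← h', mul_assoc, ← pow_add, ← two_mul, pow_mul, h2, one_pow, mul_one]

lemma quadraticChar_prod_choose_two_mul_add_one {m : ℕ} (hm : 2 * m < p) (hp : p ≠ 2) :
    quadraticChar (ZMod p) ((∏ k ∈ range (m + 1), (2 * m + 1).choose k : ℕ) : ZMod p) =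
      (quadraticChar (ZMod p) (((2 * m + 1)! : ℕ) : ZMod p) * quadraticChar (ZMod p) 2) ^ m *
        quadraticChar (ZMod p) ((m ! : ℕ) : ZMod p) := by
  have h := congrArg (fun a : ℕ => quadraticChar (ZMod p) (a : ZMod p))
    (prod_range_choose_two_mul_add_one m)
  simp only [Nat.cast_mul, map_mul, Nat.cast_pow, map_pow] at h
  rw [quadraticChar_superfactorial m hm] at h
  have hfac : quadraticChar (ZMod p) ((m ! : ℕ) : ZMod p) ^ 2 = 1 :=
    quadraticChar_sq_one (factorial_ne_zero_zmod (by omega))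
  have h2 : (quadraticChar (ZMod p) 2 ^ m) ^ 2 = 1 := by
    rw [← pow_mul, mul_comm, pow_mul, quadraticChar_sq_one, one_pow]
    refine fun h0 => hp ?_
    have : p ∣ 2 := (ZMod.natCast_eq_zero_iff 2 p).mp (by exact_mod_cast h0)
    exact (Nat.prime_dvd_prime_iff_eq Fact.out Nat.prime_two).mp this
  rw [mul_pow, ← h]
  linear_combination (-quadraticChar (ZMod p)
    ((∏ k ∈ range (m + 1), (2 * m + 1).choose k : ℕ) : ZMod p)) *
      (quadraticChar (ZMod p) 2 ^ m) ^ 2 * hfac - quadraticChar (ZMod p)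
    ((∏ k ∈ range (m + 1), (2 * m + 1).choose k : ℕ) : ZMod p) * h2

/-- Wilson's theorem for `(2n)! = C(2n, n) n!²`, with `C(2n, n) = (-1)^n` modulo `p`. -/
lemma factorial_half_sq {n : ℕ} (hn : p = 2 * n + 1) :
    (-1) ^ n * (((n ! : ℕ) : ZMod p)) ^ 2 = -1 := by
  have h := choose_two_mul_sub hn (Nat.zero_le n)
  have hw := ZMod.wilsons_lemma p
  rw [show p - 1 = 2 * n by omega,
    ← Nat.choose_mul_factorial_mul_factorial (show n ≤ 2 * n by omega),
    show 2 * n - n = n by omega] at hw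
  rw [Nat.sub_zero, Nat.choose_zero_right, pow_zero, mul_one, Nat.cast_one, mul_one] at h
  push_cast at hw ⊢
  rw [h] at hw
  linear_combination hw

end Factorials

/-! ### Quarter sums of the quadratic character and the Legendre symbol. -/

/-- A family of signs: the sum determines the product. -/
lemma four_dvd_sum_sub_card_sub_prod {ι : Type*} (s : Finset ι) (u : ι → ℤ)
    (hu : ∀ i ∈ s, u i = 1 ∨ u i = -1) :
    (4 : ℤ) ∣ (∑ i ∈ s, u i - #s) - (∏ i ∈ s, u i - 1) := by
  classical
  induction s using Finset.induction_on with
  | empty => simp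
  | insert a s ha ih =>
    have ih' := ih fun i hi => hu i (mem_insert_of_mem hi)
    have hodd : (∏ i ∈ s, u i) % 2 = 1 := by
      rw [← Int.odd_iff]
      refine Finset.prod_induction u Odd (fun _ _ => Odd.mul) odd_one fun i hi => ?_
      rcases hu i (mem_insert_of_mem hi) with h | h <;> rw [h] <;> decide
    rw [sum_insert ha, prod_insert ha, card_insert_of_notMem ha]
    push_cast
    rcases hu a (mem_insert_self a s) with h | h <;> rw [h] <;> omega

section Legendre
open Nat
variable {p : ℕ} [Fact p.Prime]

lemma quadraticChar_eq_one_or_neg_one_of_lt {a : ℕ} (h0 : 0 < a) (ha : a < p) :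
    quadraticChar (ZMod p) (a : ZMod p) = 1 ∨ quadraticChar (ZMod p) (a : ZMod p) = -1 := by
  refine quadraticChar_dichotomy ?_
  rw [Ne, ZMod.natCast_eq_zero_iff]
  exact fun h => absurd (Nat.le_of_dvd h0 h) (by omega)

/-- For `p = 4m + 3`, the sums of the quadratic character over the first and the second quarter
of the residues are related by multiplication by `2`. -/
lemma sum_quadraticChar_quarters {m : ℕ} (hp : p = 4 * m + 3) :
    ∑ i ∈ range m, quadraticChar (ZMod p) ((i + 1 : ℕ) : ZMod p) +
        ∑ i ∈ range (m + 1), quadraticChar (ZMod p) ((m + 1 + i : ℕ) : ZMod p) =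
      quadraticChar (ZMod p) 2 *
        (∑ i ∈ range m, quadraticChar (ZMod p) ((i + 1 : ℕ) : ZMod p) -
          ∑ i ∈ range (m + 1), quadraticChar (ZMod p) ((m + 1 + i : ℕ) : ZMod p)) := by
  have hneg : quadraticChar (ZMod p) (-1) = -1 := by
    refine (quadraticChar_dichotomy (by simp)).resolve_left fun h => ?_
    rw [quadraticChar_one_iff_isSquare (by simp), FiniteField.isSquare_neg_one_iff,
      ZMod.card] at h
    omega
  have hsplit : ∀ (f : ℕ → ℤ) (l : ℕ), ∑ i ∈ range (2 * l + 1), f (i + 1) =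
      ∑ i ∈ range l, f (2 * (i + 1)) + ∑ i ∈ range (l + 1), f (2 * i + 1) := by
    intro f l
    induction l with
    | zero => simp
    | succ l ih =>
      rw [show 2 * (l + 1) + 1 = 2 * l + 1 + 1 + 1 by ring, sum_range_succ, sum_range_succ, ih,
        sum_range_succ (fun i => f (2 * (i + 1))) l,
        sum_range_succ (fun i => f (2 * i + 1)) (l + 1)]
      rw [show 2 * l + 1 + 1 = 2 * (l + 1) by ring]
      ring
  have htotal : ∑ i ∈ range (2 * m + 1), quadraticChar (ZMod p) ((i + 1 : ℕ) : ZMod p) =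
      ∑ i ∈ range m, quadraticChar (ZMod p) ((i + 1 : ℕ) : ZMod p) +
        ∑ i ∈ range (m + 1), quadraticChar (ZMod p) ((m + 1 + i : ℕ) : ZMod p) := by
    rw [show 2 * m + 1 = m + (m + 1) by ring, sum_range_add]
    congr 1
    refine sum_congr rfl fun i _ => ?_
    rw [show m + i + 1 = m + 1 + i by ring]
  -- Modulo `p`, `2i + 1 = -2(2m + 1 - i)`, and `2m + 1 - i` runs through the second quarter in
  -- reverse.
  have hodd : ∑ i ∈ range (m + 1), quadraticChar (ZMod p) ((2 * i + 1 : ℕ) : ZMod p) =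
      -(quadraticChar (ZMod p) 2 *
        ∑ i ∈ range (m + 1), quadraticChar (ZMod p) ((m + 1 + i : ℕ) : ZMod p)) := by
    rw [← sum_range_reflect (fun i => quadraticChar (ZMod p) ((m + 1 + i : ℕ) : ZMod p)), mul_sum,
      ← sum_neg_distrib]
    refine sum_congr rfl fun i hi => ?_
    rw [mem_range] at hi
    have h : ((2 * i + 1 : ℕ) : ZMod p) = -1 * (2 * ((m + 1 + (m + 1 - 1 - i) : ℕ) : ZMod p)) := by
      have h0 : ((2 * i + 1 + 2 * (m + 1 + (m + 1 - 1 - i)) : ℕ) : ZMod p) = 0 := by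
        rw [ZMod.natCast_eq_zero_iff]
        exact dvd_of_eq (by omega)
      rw [Nat.cast_add, Nat.cast_mul 2 (m + 1 + (m + 1 - 1 - i))] at h0
      push_cast at h0 ⊢
      linear_combination h0
    rw [h, map_mul, map_mul, hneg, neg_one_mul]
  rw [← htotal, hsplit (fun i => quadraticChar (ZMod p) (i : ZMod p)), hodd, mul_sub, sub_eq_add_neg]
  congr 1
  rw [mul_sum]
  refine sum_congr rfl fun i _ => ?_
  rw [Nat.cast_mul, map_mul, Nat.cast_two]

lemma quadraticChar_prod_natCast (s : Finset ℕ) (u : ℕ → ℕ) :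
    ∏ i ∈ s, quadraticChar (ZMod p) (u i : ZMod p) =
      quadraticChar (ZMod p) ((∏ i ∈ s, u i : ℕ) : ZMod p) := by
  rw [Nat.cast_prod, map_prod]

/-- If `p = 4m + 3` with `m` even, then `m!` is determined modulo squares. -/
lemma four_dvd_quadraticChar_factorial_quarter {m : ℕ} (hp : p = 4 * m + 3) (hm : Even m) :
    (4 : ℤ) ∣ m + (quadraticChar (ZMod p) ((m ! : ℕ) : ZMod p) - 1) := by
  have h2 : quadraticChar (ZMod p) 2 = -1 := by
    have h2ne : (2 : ZMod p) ≠ 0 := fun h0 => by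
      have := Nat.le_of_dvd two_pos ((ZMod.natCast_eq_zero_iff 2 p).mp (by exact_mod_cast h0))
      omega
    refine (quadraticChar_dichotomy h2ne).resolve_left fun h => ?_
    rw [quadraticChar_one_iff_isSquare h2ne, FiniteField.isSquare_two_iff, ZMod.card] at h
    obtain ⟨c, rfl⟩ := hm
    omega
  have hsum := sum_quadraticChar_quarters hp
  rw [h2] at hsum
  -- Here `p ≡ 3 (mod 8)`, so `2` is a nonresidue and the quarter relation kills the first quarter.
  have hzero : ∑ i ∈ range m, quadraticChar (ZMod p) ((i + 1 : ℕ) : ZMod p) = 0 := by linarith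
  have hdvd := four_dvd_sum_sub_card_sub_prod (range m)
    (fun i => quadraticChar (ZMod p) ((i + 1 : ℕ) : ZMod p)) fun i hi => by
      rw [mem_range] at hi
      exact quadraticChar_eq_one_or_neg_one_of_lt (by omega) (by omega)
  rw [hzero, card_range, quadraticChar_prod_natCast, prod_range_add_one_eq_factorial] at hdvd
  omega

/-- If `p = 4m + 3` with `m` odd, then `(2m + 1)! m!` is determined modulo squares. -/
lemma four_dvd_quadraticChar_factorial_half {m : ℕ} (hp : p = 4 * m + 3) (hm : Odd m) :
    (4 : ℤ) ∣ (m + 1) + (quadraticChar (ZMod p) (((2 * m + 1)! : ℕ) : ZMod p) *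
      quadraticChar (ZMod p) ((m ! : ℕ) : ZMod p) - 1) := by
  have h2 : quadraticChar (ZMod p) 2 = 1 := by
    have h2ne : (2 : ZMod p) ≠ 0 := fun h0 => by
      have := Nat.le_of_dvd two_pos ((ZMod.natCast_eq_zero_iff 2 p).mp (by exact_mod_cast h0))
      omega
    rw [quadraticChar_one_iff_isSquare h2ne, FiniteField.isSquare_two_iff, ZMod.card]
    obtain ⟨c, rfl⟩ := hm
    omega
  have hsum := sum_quadraticChar_quarters hp
  rw [h2] at hsum
  -- Here `p ≡ 7 (mod 8)`, so `2` is a residue and the second quarter vanishes; its product is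
  -- `(2m+1)!/m!`.
  have hzero : ∑ i ∈ range (m + 1), quadraticChar (ZMod p) ((m + 1 + i : ℕ) : ZMod p) = 0 := by
    linarith
  have hdvd := four_dvd_sum_sub_card_sub_prod (range (m + 1))
    (fun i => quadraticChar (ZMod p) ((m + 1 + i : ℕ) : ZMod p)) fun i hi => by
      rw [mem_range] at hi
      exact quadraticChar_eq_one_or_neg_one_of_lt (by omega) (by omega)
  have hfac : (2 * m + 1)! = m ! * ∏ i ∈ range (m + 1), (m + 1 + i) := by
    rw [← prod_range_add_one_eq_factorial, ← prod_range_add_one_eq_factorial,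
      show 2 * m + 1 = m + (m + 1) by ring, prod_range_add]
    congr 1
    refine prod_congr rfl fun i _ => ?_
    ring
  have hm1 : quadraticChar (ZMod p) ((m ! : ℕ) : ZMod p) ^ 2 = 1 :=
    quadraticChar_sq_one (factorial_ne_zero_zmod (by omega))
  rw [hzero, card_range, quadraticChar_prod_natCast] at hdvd
  have hprod : quadraticChar (ZMod p) (((2 * m + 1)! : ℕ) : ZMod p) *
      quadraticChar (ZMod p) ((m ! : ℕ) : ZMod p) =
      quadraticChar (ZMod p) ((∏ i ∈ range (m + 1), (m + 1 + i) : ℕ) : ZMod p) := by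
    rw [hfac, Nat.cast_mul, map_mul]
    linear_combination quadraticChar (ZMod p)
      ((∏ i ∈ range (m + 1), (m + 1 + i) : ℕ) : ZMod p) * hm1
  rw [hprod]
  push_cast at hdvd
  push_cast
  omega

lemma prod_range_four_mul_neg_one_pow (c : ℕ) : ∏ k ∈ range (4 * c), (-1 : ℤ) ^ k = 1 := by
  induction c with
  | zero => simp
  | succ c ih =>
    rw [show 4 * (c + 1) = 4 * c + 1 + 1 + 1 + 1 by ring, prod_range_succ, prod_range_succ,
      prod_range_succ, prod_range_succ, ih]
    have h : ((-1 : ℤ) ^ (4 * c)) = 1 := by rw [pow_mul]; norm_num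
    simp only [pow_succ, h]
    norm_num

/-- Signs are squares, so the symbol is that of `(2 · (2M)!)^M` with `n = 2M`. For `M` even this is
a square; for `M` odd both `2` and `(2M)!` are nonresidues. -/
lemma quadraticChar_prod_halfRange_of_mod_four_eq_one {n : ℕ} (hn : p = 2 * n + 1)
    (hp : p % 4 = 1) :
    quadraticChar (ZMod p) (∏ k ∈ halfRange n, (-(-1) ^ k * (n.choose k : ZMod p))) = 1 := by
  obtain ⟨M, rfl⟩ : ∃ M, n = 2 * M := ⟨n / 2, by omega⟩
  have hprime : p.Prime := Fact.out
  have hM : 0 < M := by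
    have := hprime.two_le
    omega
  have hneg : quadraticChar (ZMod p) (-1) = 1 := by
    rw [quadraticChar_one_iff_isSquare (by simp), FiniteField.isSquare_neg_one_iff, ZMod.card]
    omega
  have hterm : ∀ k, quadraticChar (ZMod p) (-(-1) ^ k * ((2 * M).choose k : ZMod p)) =
      quadraticChar (ZMod p) (((2 * M).choose k : ℕ) : ZMod p) := by
    intro k
    rw [neg_mul, ← neg_one_mul, map_mul, map_mul, map_pow, hneg]
    simp
  have hrange : ∏ k ∈ halfRange (2 * M), quadraticChar (ZMod p)
      (((2 * M).choose k : ℕ) : ZMod p) = ∏ k ∈ range M, quadraticChar (ZMod p)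
      (((2 * M).choose k : ℕ) : ZMod p) := by
    obtain ⟨m, rfl⟩ : ∃ m, M = m + 1 := ⟨M - 1, by omega⟩
    rw [prod_halfRange, show (2 * (m + 1) - 1) / 2 = m by omega, prod_range_succ' _ m]
    simp
  rw [map_prod, prod_congr rfl fun k _ => hterm k, hrange, quadraticChar_prod_natCast,
    quadraticChar_prod_choose_two_mul (by omega) (by omega)]
  have h2ne : (2 : ZMod p) ≠ 0 := fun h0 => by
    have := Nat.le_of_dvd two_pos ((ZMod.natCast_eq_zero_iff 2 p).mp (by exact_mod_cast h0))
    omega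
  have hfne : (((2 * M)! : ℕ) : ZMod p) ≠ 0 := factorial_ne_zero_zmod (by omega)
  rcases Nat.even_or_odd M with hev | hodd
  · obtain ⟨c, hc⟩ := hev
    conv_lhs =>
      arg 2
      rw [hc]
    rw [← two_mul, pow_mul, mul_pow, quadraticChar_sq_one h2ne, quadraticChar_sq_one hfne,
      mul_one, one_pow]
  · have h2 : quadraticChar (ZMod p) 2 = -1 := by
      refine (quadraticChar_dichotomy h2ne).resolve_left fun h => ?_
      rw [quadraticChar_one_iff_isSquare h2ne, FiniteField.isSquare_two_iff, ZMod.card] at h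
      obtain ⟨c, rfl⟩ := hodd
      omega
    have hsq := factorial_half_sq hn
    rw [pow_mul, neg_one_sq, one_pow, one_mul] at hsq
    have hone : (-1 : ZMod p) ≠ 1 := fun h => h2ne (by linear_combination -h)
    have hfac : quadraticChar (ZMod p) (((2 * M)! : ℕ) : ZMod p) = -1 := by
      refine (quadraticChar_dichotomy hfne).resolve_left fun h => ?_
      -- Euler's criterion: `(2M)!^(2M) = (-1)^M = -1`, since `(2M)!² = -1`.
      have hpow := quadraticChar_eq_pow_of_char_ne_two'
        (by rw [ZMod.ringChar_zmod_n]; omega : ringChar (ZMod p) ≠ 2) (((2 * M)! : ℕ) : ZMod p)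
      rw [h, ZMod.card, show p / 2 = 2 * M by omega, pow_mul, hsq, hodd.neg_one_pow,
        Int.cast_one] at hpow
      exact hone hpow.symm
    rw [h2, hfac]
    norm_num

/-- With `p = 4m + 3` the signs contribute `∏_{k<m} (-1)^k`, which depends on `m` modulo 4. The
binomials leave the symbol of `m!` for `m` even and of `(2m+1)! m!` for `m` odd, and the quarter
sums determine these modulo 4 as well. -/
lemma quadraticChar_prod_halfRange_of_mod_four_eq_three {n : ℕ} (hn : p = 2 * n + 1)
    (hp : p % 4 = 3) :
    quadraticChar (ZMod p) (∏ k ∈ halfRange n, (-(-1) ^ k * (n.choose k : ZMod p))) =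
      (-1) ^ ((p - 3) / 4) := by
  obtain ⟨m, rfl⟩ : ∃ m, n = 2 * m + 1 := ⟨n / 2, by omega⟩
  have hpm : p = 4 * m + 3 := by omega
  have hneg : quadraticChar (ZMod p) (-1) = -1 := by
    refine (quadraticChar_dichotomy (by simp)).resolve_left fun h => ?_
    rw [quadraticChar_one_iff_isSquare (by simp), FiniteField.isSquare_neg_one_iff,
      ZMod.card] at h
    omega
  have hterm : ∀ k, quadraticChar (ZMod p) (-(-1) ^ (k + 1) *
      ((2 * m + 1).choose (k + 1) : ZMod p)) = (-1) ^ k *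
      quadraticChar (ZMod p) (((2 * m + 1).choose (k + 1) : ℕ) : ZMod p) := by
    intro k
    rw [map_mul, show -(-1 : ZMod p) ^ (k + 1) = (-1) ^ k by ring, map_pow, hneg]
  have hrange : ∏ k ∈ range m, quadraticChar (ZMod p)
      (((2 * m + 1).choose (k + 1) : ℕ) : ZMod p) = ∏ k ∈ range (m + 1), quadraticChar (ZMod p)
      (((2 * m + 1).choose k : ℕ) : ZMod p) := by
    rw [prod_range_succ' _ m]
    simp
  rw [map_prod, prod_halfRange, show (2 * m + 1 - 1) / 2 = m by omega,
    prod_congr rfl fun k _ => hterm k, prod_mul_distrib, hrange, quadraticChar_prod_natCast,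
    quadraticChar_prod_choose_two_mul_add_one (by omega) (by omega),
    show (p - 3) / 4 = m by omega]
  have hM := quadraticChar_dichotomy (factorial_ne_zero_zmod (p := p) (a := m) (by omega))
  have hN := quadraticChar_dichotomy (factorial_ne_zero_zmod (p := p) (a := 2 * m + 1) (by omega))
  have h2ne : (2 : ZMod p) ≠ 0 := fun h0 => by
    have := Nat.le_of_dvd two_pos ((ZMod.natCast_eq_zero_iff 2 p).mp (by exact_mod_cast h0))
    omega
  rcases Nat.even_or_odd m with hev | hodd
  · have hdvd := four_dvd_quadraticChar_factorial_quarter hpm hev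
    have hsq : (quadraticChar (ZMod p) (((2 * m + 1)! : ℕ) : ZMod p) *
        quadraticChar (ZMod p) 2) ^ m = 1 := by
      obtain ⟨c, hc⟩ := hev
      conv_lhs => rw [hc]
      rw [← two_mul, pow_mul, mul_pow, quadraticChar_sq_one h2ne,
        quadraticChar_sq_one (factorial_ne_zero_zmod (by omega))]
      simp
    rw [hsq, hev.neg_one_pow, one_mul]
    generalize quadraticChar (ZMod p) ((m ! : ℕ) : ZMod p) = b at *
    obtain ⟨c, rfl | rfl⟩ : ∃ c, m = 4 * c ∨ m = 4 * c + 2 := by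
      obtain ⟨d, hd⟩ := hev
      exact ⟨m / 4, by omega⟩
    · rw [prod_range_four_mul_neg_one_pow]
      push_cast at hdvd
      omega
    · rw [show 4 * c + 2 = 4 * c + 1 + 1 by ring, prod_range_succ, prod_range_succ,
        prod_range_four_mul_neg_one_pow, pow_succ, pow_mul]
      push_cast at hdvd
      norm_num
      omega
  · have hdvd := four_dvd_quadraticChar_factorial_half hpm hodd
    have h2 : quadraticChar (ZMod p) 2 = 1 := by
      rw [quadraticChar_one_iff_isSquare h2ne, FiniteField.isSquare_two_iff, ZMod.card]
      obtain ⟨c, rfl⟩ := hodd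
      omega
    have hpow : quadraticChar (ZMod p) (((2 * m + 1)! : ℕ) : ZMod p) ^ m =
        quadraticChar (ZMod p) (((2 * m + 1)! : ℕ) : ZMod p) := by
      obtain ⟨c, hc⟩ := hodd
      rcases hN with h | h <;> rw [h]
      · rw [one_pow]
      · rw [hc, pow_succ, pow_mul, neg_one_sq, one_pow, one_mul]
    rw [h2, mul_one, hpow, hodd.neg_one_pow]
    have hab : quadraticChar (ZMod p) (((2 * m + 1)! : ℕ) : ZMod p) *
        quadraticChar (ZMod p) ((m ! : ℕ) : ZMod p) = 1 ∨
        quadraticChar (ZMod p) (((2 * m + 1)! : ℕ) : ZMod p) *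
        quadraticChar (ZMod p) ((m ! : ℕ) : ZMod p) = -1 := by
      rcases hM with h | h <;> rcases hN with h' | h' <;> rw [h, h'] <;> norm_num
    generalize quadraticChar (ZMod p) (((2 * m + 1)! : ℕ) : ZMod p) *
        quadraticChar (ZMod p) ((m ! : ℕ) : ZMod p) = b at *
    obtain ⟨c, rfl | rfl⟩ : ∃ c, m = 4 * c + 1 ∨ m = 4 * c + 3 := by
      obtain ⟨d, hd⟩ := hodd
      exact ⟨m / 4, by omega⟩
    · rw [prod_range_succ, prod_range_four_mul_neg_one_pow, pow_mul]
      push_cast at hdvd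
      norm_num
      omega
    · rw [show 4 * c + 3 = 4 * c + 1 + 1 + 1 by ring, prod_range_succ, prod_range_succ,
        prod_range_succ, prod_range_four_mul_neg_one_pow, pow_succ _ (4 * c + 1),
        pow_succ _ (4 * c), pow_mul]
      push_cast at hdvd
      norm_num
      omega

end Legendre

/-! ### Assembly over the prime field and the main theorem. -/

/-- The reduction of the product of paired Jacobi sums over a prime field. -/
lemma jacobiPairProduct_intCast_zmod {F : Type*} [Field F] [Fintype F] {p n : ℕ} [Fact p.Prime]
    (hF : Fintype.card F = p) (hn : p = 2 * n + 1) {ω : MulChar F F} (hω : ∀ x, ω x = x) {R : ℤ}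
    (hR : jacobiPairProduct n ω = (R : F)) :
    (R : ZMod p) = ∏ k ∈ halfRange n, (-(-1) ^ k * (n.choose k : ZMod p)) := by
  have : CharP F p := charP_of_card_eq_prime_pow (f := 1) (by rw [hF, pow_one])
  -- `ZMod p` embeds in `F`, so the identity may be checked there.
  refine (ZMod.castHom (dvd_refl p) F).injective ?_
  rw [map_intCast, ← hR, jacobiPairProduct_identityChar (hF.trans hn) hω, map_prod]
  refine prod_congr rfl fun k hk => ?_
  rw [mem_halfRange] at hk
  have hc := choose_two_mul_sub hn (show k ≤ n by omega)
  have h : (-(-1) ^ k * (n.choose k : ZMod p)) =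
      -(-1) ^ n * ((2 * n - k).choose n : ZMod p) := by
    have h1 : ((-1 : ZMod p) ^ n) * (-1) ^ n = 1 := by rw [← mul_pow]; simp
    rw [hc]
    linear_combination (-1) ^ k * (n.choose k : ZMod p) * h1
  rw [h]
  simp

lemma neg_one_pow_mul_choose_eq {p n : ℕ} [Fact p.Prime] (hn : p = 2 * n + 1) {k : ℕ}
    (hk : k ≤ n) : -(-1) ^ k * (n.choose k : ZMod p) =
      -1 * (1 / 4) ^ k * ((2 * k).choose k : ZMod p) := by
  have h4 : (4 : ZMod p) ≠ 0 := by
    intro h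
    have h0 := two_mul_add_one_eq_zero_of_eq hn
    have h2 : (2 : ZMod p) = 0 := by
      have : (2 : ZMod p) ^ 2 = 0 := by rw [← h]; norm_num
      exact pow_eq_zero_iff two_ne_zero |>.mp this
    rw [h2] at h0
    simp at h0
  have h1 : (1 / 4 : ZMod p) ^ k * 4 ^ k = 1 := by
    rw [← mul_pow, one_div_mul_cancel h4, one_pow]
  rw [← neg_four_pow_mul_choose hn hk, neg_pow (4 : ZMod p)]
  linear_combination (-1) ^ k * (n.choose k : ZMod p) * h1

theorem theorem1p3 {F K : Type*} [Field F] [Fintype F] [Field K] [CharZero K] [IsAlgClosed K]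
    (p f n : ℕ) [Fact p.Prime] (hp : p ≠ 2) (hf : 0 < f)
    (hq : Fintype.card F = p ^ f) (hn : p ^ f = 2 * n + 1) :
    ∃ R : ℤ,
      (∀ χ : MulChar F K, IsCharGenerator χ → jacobiProduct χ = (R : K)) ∧
      (1 < f → p ^ f ≠ 9 → R ≡ 0 [ZMOD (p : ℤ)]) ∧
      (p ^ f = 9 → R = -2) ∧
      (f = 1 →
        (R : ZMod p) =
          (-1) ^ ((n - 1) / 2) * (1 / 4) ^ ((n - 1) / 2 * ((n - 1) / 2 + 1) / 2) *
            ∏ k ∈ (Finset.range n).filter (fun k : ℕ => 0 < k ∧ 2 * k < n),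
              ((2 * k).choose k : ZMod p)) ∧
      (f = 1 → p % 4 = 3 → legendreSym p R = (-1) ^ ((p - 3) / 4)) ∧
      (f = 1 → p % 4 = 1 → legendreSym p R = 1) := by
  have hF : Fintype.card F = 2 * n + 1 := hq.trans hn
  obtain ⟨R, ω, hR, hω, hRω⟩ := exists_int_jacobiPairProduct (F := F) (K := K) hF
  have hprime : f = 1 → p = 2 * n + 1 ∧
      (R : ZMod p) = ∏ k ∈ halfRange n, (-(-1) ^ k * (n.choose k : ZMod p)) := by
    rintro rfl
    rw [pow_one] at hq hn
    exact ⟨hn, jacobiPairProduct_intCast_zmod hq hn hω hRω⟩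
  refine ⟨R, fun χ hχ => ?_, fun hf1 h9 => ?_, fun h9 => ?_, fun hf1 => ?_, fun hf1 hp4 => ?_,
    fun hf1 hp4 => ?_⟩
  · rw [jacobiProduct_eq_jacobiPairProduct hF, hR χ hχ]
  · have : CharP F p := charP_of_card_eq_prime_pow hq
    obtain ⟨k, hk, hdvd⟩ := exists_choose_modEq_zero hp hf1 h9 hn
    rw [Int.modEq_zero_iff_dvd, ← CharP.intCast_eq_zero_iff F p, ← hRω,
      jacobiPairProduct_identityChar hF hω]
    refine prod_eq_zero hk ?_
    rw [(CharP.cast_eq_zero_iff F p _).mpr hdvd, mul_zero]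
  -- `R` is the same for every generator, so a faithful one may be used; for `n = 4` the only index
  -- is `k = 1`.
  · obtain ⟨χ, hχ, hinj⟩ := exists_isCharGenerator (F := F) (K := K) hF
    have hn4 : n = 4 := by omega
    have h1 : halfRange 4 = {1} := by decide
    have h := hR χ hχ
    rw [jacobiPairProduct, hn4, h1, prod_singleton, Nat.cast_one,
      jacobiPairSum_one_of_card_eq_nine (hq.trans h9) hinj] at h
    exact_mod_cast h.symm
  · obtain ⟨hpn, hRp⟩ := hprime hf1
    change _ = _ * ∏ k ∈ halfRange n, _
    -- The exponents of `1/4` add up to `1 + ⋯ + m = m(m+1)/2` with `m = (n - 1) / 2`.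
    have hexp : ∏ k ∈ halfRange n, (-1 * (1 / 4) ^ k : ZMod p) =
        (-1) ^ ((n - 1) / 2) * (1 / 4) ^ ((n - 1) / 2 * ((n - 1) / 2 + 1) / 2) := by
      rw [prod_halfRange, prod_mul_distrib, prod_const, card_range, prod_pow_eq_pow_sum,
        ← add_zero (∑ i ∈ range _, (i + 1)), ← sum_range_succ' (fun i => i), sum_range_id, Nat.add_sub_cancel,
        mul_comm (_ + 1)]
    rw [hRp, ← hexp, ← prod_mul_distrib]
    refine prod_congr rfl fun k hk => ?_
    rw [mem_halfRange] at hk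
    exact neg_one_pow_mul_choose_eq hpn (by omega)
  · obtain ⟨hpn, hRp⟩ := hprime hf1
    rw [legendreSym, hRp]
    exact quadraticChar_prod_halfRange_of_mod_four_eq_three hpn hp4
  · obtain ⟨hpn, hRp⟩ := hprime hf1
    rw [legendreSym, hRp]
    exact quadraticChar_prod_halfRange_of_mod_four_eq_one hpn hp4
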